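/- **Proposition 4.1.** Let $R$ be a commutative ring with unity and let $C$ be a semidualizing $R$-module, that is, an $R$-module such that (a) $C$ has a projective resolution by finitely generated projective modules, (b) the homothety map $R\to\operatorname{Hom}_R(C,C)$, $r\mapsto(c\mapsto rc)$, is an isomorphism, and (c) $\operatorname{Ext}^i_R(C,C)=0$ for all $i\ge 1$. Let $\mathcal P_C$ be the class of $R$-modules isomorphic to $C\otimes_R P$ with $P$ a projective $R$-module, and let $\mathcal I_C$ be the class of $R$-modules isomorphic to $\operatorname{Hom}_R(C,I)$ with $I$ an injective $R$-module. For an $R$-module $M$, let $$\mathcal P_C\text{-}\mathrm{pd}_R(M)=\inf\bigl\{\sup\{n\ge 0\mid X_n\ne 0\}\bigr\},$$ the infimum being taken over all exact sequences $\cdots\to X_1\to X_0\to M\to 0$ with every $X_n$ in $\mathcal P_C$, and let $$\mathcal I_C\text{-}\mathrm{id}_R(M)=\inf\bigl\{\sup\{n\ge 0\mid X^n\ne 0\}\bigr\},$$ the infimum being taken over all exact sequences $0\to M\to X^0\to X^1\to\cdots$ with every $X^n$ in $\mathcal I_C$ (with $\inf\emptyset=\infty$ and $\sup\emptyset=-\infty$).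 Then $$\sup_M\,\mathcal P_C\text{-}\mathrm{pd}_R(M)=\sup_M\,\mathcal I_C\text{-}\mathrm{id}_R(M)=\operatorname{gldim}(R),$$ where $M$ ranges over all $R$-modules and $\operatorname{gldim}(R)=\sup_M\operatorname{pd}_R(M)$ is the classical global dimension of $R$ (the projective dimension of the zero module being $-\infty$). -/

import Mathlib

open CategoryTheory
open scoped TensorProduct

universe u

noncomputable section

namespace RelDim

variable {R : Type u} [CommRing R]

/-- An `𝒳`-resolution of a module `M`: an exact sequence
`⋯ ⟶ X₂ ⟶ X₁ ⟶ X₀ ⟶ M ⟶ 0` with every `Xₙ` in the class `𝒳`. -/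
structure Resolution (𝒳 : ModuleCat.{u} R → Prop) (M : ModuleCat.{u} R) where
  X : ℕ → ModuleCat.{u} R
  mem : ∀ n, 𝒳 (X n)
  d : ∀ n, X (n + 1) →ₗ[R] X n
  ε : X 0 →ₗ[R] M
  ε_surjective : Function.Surjective ε
  exact_zero : Function.Exact (d 0) ε
  exact_succ : ∀ n, Function.Exact (d (n + 1)) (d n)

/-- An `𝒳`-coresolution of a module `M`: an exact sequence
`0 ⟶ M ⟶ X⁰ ⟶ X¹ ⟶ X² ⟶ ⋯` with every `Xⁿ` in the class `𝒳`. -/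
structure Coresolution (𝒳 : ModuleCat.{u} R → Prop) (M : ModuleCat.{u} R) where
  X : ℕ → ModuleCat.{u} R
  mem : ∀ n, 𝒳 (X n)
  d : ∀ n, X n →ₗ[R] X (n + 1)
  η : M →ₗ[R] X 0
  η_injective : Function.Injective η
  exact_zero : Function.Exact η (d 0)
  exact_succ : ∀ n, Function.Exact (d n) (d (n + 1))

/-- `sup {n ≥ 0 | Xₙ ≠ 0}`, which is `⊥` (that is, `-∞`) if all `Xₙ` vanish and `⊤` if infinitely
many do not. -/
def seqLength (X : ℕ → ModuleCat.{u} R) : WithBot ℕ∞ :=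
  sSup {k : WithBot ℕ∞ | ∃ n : ℕ, Nontrivial (X n) ∧ k = ((n : ℕ∞) : WithBot ℕ∞)}

/-- The `𝒳`-projective dimension of `M`: the infimum of the lengths of the `𝒳`-resolutions of `M`.
It is `⊤` if there are none. -/
def relProjDim (𝒳 : ModuleCat.{u} R → Prop) (M : ModuleCat.{u} R) : WithBot ℕ∞ :=
  ⨅ F : Resolution 𝒳 M, seqLength F.X

/-- The `𝒳`-injective dimension of `M`: the infimum of the lengths of the `𝒳`-coresolutions of `M`.
It is `⊤` if there are none. -/
def relInjDim (𝒳 : ModuleCat.{u} R → Prop) (M : ModuleCat.{u} R) : WithBot ℕ∞ :=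
  ⨅ F : Coresolution 𝒳 M, seqLength F.X

/-- Semidualizing modules. -/
structure IsSemidualizing (C : ModuleCat.{u} R) : Prop where
  /-- `C` has a degreewise finite projective resolution. -/
  exists_resolution : Nonempty
    (Resolution (fun P : ModuleCat.{u} R ↦ Module.Finite R P ∧ Module.Projective R P) C)
  /-- The homothety map `R → Hom_R(C, C)`, `r ↦ (c ↦ r • c)`, is an isomorphism. -/
  homothety_bijective : Function.Bijective (LinearMap.lsmul R C)
  /-- `Ext^i_R(C, C) = 0` for all `i ≥ 1`. -/
  ext_vanishing : ∀ i : ℕ, 1 ≤ i → Subsingleton (Abelian.Ext.{u} C C i)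

/-- The class `𝒫_C` of the modules of the form `C ⊗ P` with `P` projective. -/
def CProjective (C : ModuleCat.{u} R) (M : ModuleCat.{u} R) : Prop :=
  ∃ P : ModuleCat.{u} R, Module.Projective R P ∧ Nonempty (M ≃ₗ[R] (C ⊗[R] P))

/-- The class `ℐ_C` of the modules of the form `Hom(C, I)` with `I` injective. -/
def CInjective (C : ModuleCat.{u} R) (M : ModuleCat.{u} R) : Prop :=
  ∃ I : ModuleCat.{u} R, Module.Injective R I ∧ Nonempty (M ≃ₗ[R] (C →ₗ[R] I))

/-- The `𝒫_C`-projective dimension of the ring `R`. -/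
def CProjGlobalDim (C : ModuleCat.{u} R) : WithBot ℕ∞ :=
  ⨆ M : ModuleCat.{u} R, relProjDim (CProjective C) M

/-- The `ℐ_C`-injective dimension of the ring `R`. -/
def CInjGlobalDim (C : ModuleCat.{u} R) : WithBot ℕ∞ :=
  ⨆ M : ModuleCat.{u} R, relInjDim (CInjective C) M

variable (R) in
/-- The classical global dimension of `R`: the supremum of the projective dimensions of all
`R`-modules. -/
def gldim : WithBot ℕ∞ :=
  ⨆ M : ModuleCat.{u} R, projectiveDimension M

end RelDim

end

noncomputable section

namespace RelDim

variable {R : Type u} [CommRing R]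

/-! Everything turns on whether `C` is projective. If it is, then `R ≅ Hom(C, C) ≅ C* ⊗ C` makes `C`
invertible, so `𝒫_C` and `ℐ_C` are exactly the projective and injective modules (`cProjective_iff`,
`cInjective_iff`) and all three suprema are classical.

If it is not, all three are `⊤`, because finiteness of any one forces projectivity. A
`𝒫_C`-resolution of `R` gives a surjection `C ⊗ P → R`, so the trace ideal of `C` is `R`; with
`End(C) = R` this exhibits `C` as a summand of a finite free module (`projective_of_sum_eq_one`).
Dually, an injective module containing `R/tr(C)` cannot embed in any `Hom(C, I)` unless `tr(C) = R`
(`apply_eq_zero_of_traceIdeal_smul`). Finally, if `pd C` is finite, vanishing of `Ext^i(C, C)`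
splits the finite resolution from its far end (`projective_of_ext_vanishing`). -/

lemma withBot_enat_le_of_forall_lt {a b : WithBot ℕ∞}
    (h : ∀ n : ℕ, b < (n : WithBot ℕ∞) → a < (n : WithBot ℕ∞)) : a ≤ b := by
  induction b with
  | bot =>
    -- Only `⊥` lies below `0`, so `n = 0` handles `b = ⊥`.
    have := h 0 (by simp)
    simp only [Nat.cast_zero, WithBot.lt_zero_iff_eq_bot] at this
    simp [this]
  | coe b =>
    induction b with
    | top => exact le_top
    | coe k =>
      have := h (k + 1) (by norm_cast; exact Nat.lt_succ_self k)
      rw [Nat.cast_add, Nat.cast_one, ENat.WithBot.lt_add_one_iff] at this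
      exact this

lemma seqLength_lt_iff (X : ℕ → ModuleCat.{u} R) (n : ℕ) :
    seqLength X < n ↔ ∀ m, n ≤ m → Subsingleton (X m) := by
  constructor
  · intro h m hm
    by_contra hX
    rw [not_subsingleton_iff_nontrivial] at hX
    have h1 : (((m : ℕ∞) : WithBot ℕ∞)) ≤ seqLength X := le_sSup ⟨m, hX, rfl⟩
    have h2 := h1.trans_lt h
    norm_cast at h2
    omega
  · intro h
    cases n with
    | zero =>
      rw [Nat.cast_zero, WithBot.lt_zero_iff_eq_bot, seqLength, sSup_eq_bot]
      rintro _ ⟨m, hm, -⟩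
      exact absurd (h m (Nat.zero_le _)) (not_subsingleton_iff_nontrivial.2 hm)
    | succ n =>
      rw [Nat.cast_add, Nat.cast_one, ENat.WithBot.lt_add_one_iff]
      refine sSup_le ?_
      rintro _ ⟨m, hm, rfl⟩
      have : m ≤ n := by
        by_contra hmn
        exact absurd (h m (by omega)) (not_subsingleton_iff_nontrivial.2 hm)
      norm_cast

lemma relProjDim_lt_iff (𝒳 : ModuleCat.{u} R → Prop) (M : ModuleCat.{u} R) (n : ℕ) :
    relProjDim 𝒳 M < n ↔ ∃ F : Resolution 𝒳 M, ∀ m, n ≤ m → Subsingleton (F.X m) := by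
  simp only [relProjDim, iInf_lt_iff, seqLength_lt_iff]

lemma relInjDim_lt_iff (𝒳 : ModuleCat.{u} R → Prop) (M : ModuleCat.{u} R) (n : ℕ) :
    relInjDim 𝒳 M < n ↔ ∃ F : Coresolution 𝒳 M, ∀ m, n ≤ m → Subsingleton (F.X m) := by
  simp only [relInjDim, iInf_lt_iff, seqLength_lt_iff]

/-! ### Truncating and splicing resolutions and coresolutions -/

namespace Resolution

variable {𝒳 : ModuleCat.{u} R → Prop} {M : ModuleCat.{u} R}

/-- The resolution of the first syzygy of a resolution. -/
def syzygy (F : Resolution 𝒳 M) : Resolution 𝒳 (ModuleCat.of R (LinearMap.ker F.ε)) where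
  X n := F.X (n + 1)
  mem n := F.mem (n + 1)
  d n := F.d (n + 1)
  ε := (F.d 0).codRestrict _ fun x ↦ F.exact_zero.apply_apply_eq_zero x
  ε_surjective := fun ⟨y, hy⟩ ↦ by
    obtain ⟨x, rfl⟩ := (F.exact_zero y).1 hy
    exact ⟨x, rfl⟩
  exact_zero x := by
    rw [← F.exact_succ 0 x, Subtype.ext_iff]
    rfl
  exact_succ n := F.exact_succ (n + 1)

/-- The zero resolution of a zero module. -/
def zero (h0 : 𝒳 (ModuleCat.of R PUnit)) [Subsingleton M] : Resolution 𝒳 M where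
  X _ := ModuleCat.of R PUnit
  mem _ := h0
  d _ := 0
  ε := 0
  ε_surjective _ := ⟨0, Subsingleton.elim _ _⟩
  exact_zero _ := ⟨fun _ ↦ ⟨0, Subsingleton.elim _ _⟩, fun _ ↦ Subsingleton.elim _ _⟩
  exact_succ _ _ := ⟨fun _ ↦ ⟨0, Subsingleton.elim _ _⟩, fun _ ↦ Subsingleton.elim _ _⟩

/-- The objects of the sequence obtained by prepending `P`. -/
abbrev consX (P : ModuleCat.{u} R) (X : ℕ → ModuleCat.{u} R) : ℕ → ModuleCat.{u} R
  | 0 => P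
  | n + 1 => X n

/-- Splicing a surjection with a resolution of its kernel. -/
def cons (P : ModuleCat.{u} R) (hP : 𝒳 P) (ε : P →ₗ[R] M) (hε : Function.Surjective ε)
    (F : Resolution 𝒳 (ModuleCat.of R (LinearMap.ker ε))) : Resolution 𝒳 M where
  X := consX P F.X
  mem
    | 0 => hP
    | n + 1 => F.mem n
  d
    | 0 => (LinearMap.ker ε).subtype ∘ₗ F.ε
    | n + 1 => F.d n
  ε := ε
  ε_surjective := hε
  exact_zero x := by
    constructor
    · intro hx
      obtain ⟨y, hy⟩ := F.ε_surjective ⟨x, hx⟩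
      exact ⟨y, congrArg Subtype.val hy⟩
    · rintro ⟨y, rfl⟩
      exact (F.ε y).2
  exact_succ
    | 0 => fun x ↦ by
      rw [← F.exact_zero x]
      exact (Subtype.ext_iff (a1 := F.ε x) (a2 := 0)).symm
    | n + 1 => F.exact_succ n

end Resolution

namespace Coresolution

variable {𝒳 : ModuleCat.{u} R → Prop} {M : ModuleCat.{u} R}

/-- The coresolution of the first cosyzygy of a coresolution. -/
def cosyzygy (F : Coresolution 𝒳 M) :
    Coresolution 𝒳 (ModuleCat.of R (F.X 0 ⧸ LinearMap.range F.η)) where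
  X n := F.X (n + 1)
  mem n := F.mem (n + 1)
  d n := F.d (n + 1)
  η := (LinearMap.range F.η).liftQ (F.d 0) (by
    rintro _ ⟨x, rfl⟩
    exact F.exact_zero.apply_apply_eq_zero x)
  η_injective := by
    rw [← LinearMap.ker_eq_bot, Submodule.ker_liftQ_eq_bot]
    exact fun x hx ↦ (F.exact_zero x).1 hx
  exact_zero x := by
    rw [F.exact_succ 0 x]
    constructor
    · rintro ⟨y, rfl⟩
      exact ⟨Submodule.Quotient.mk y, rfl⟩
    · rintro ⟨y, rfl⟩
      obtain ⟨y, rfl⟩ := Submodule.Quotient.mk_surjective _ y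
      exact ⟨y, rfl⟩
  exact_succ n := F.exact_succ (n + 1)

/-- The zero coresolution of a zero module. -/
def zero (h0 : 𝒳 (ModuleCat.of R PUnit)) [Subsingleton M] : Coresolution 𝒳 M where
  X _ := ModuleCat.of R PUnit
  mem _ := h0
  d _ := 0
  η := 0
  η_injective := Function.injective_of_subsingleton _
  exact_zero _ := ⟨fun _ ↦ ⟨0, Subsingleton.elim _ _⟩, fun _ ↦ Subsingleton.elim _ _⟩
  exact_succ _ _ := ⟨fun _ ↦ ⟨0, Subsingleton.elim _ _⟩, fun _ ↦ Subsingleton.elim _ _⟩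

/-- Splicing an injection with a coresolution of its cokernel. -/
def cons (I : ModuleCat.{u} R) (hI : 𝒳 I) (η : M →ₗ[R] I) (hη : Function.Injective η)
    (F : Coresolution 𝒳 (ModuleCat.of R (I ⧸ LinearMap.range η))) : Coresolution 𝒳 M where
  X := Resolution.consX I F.X
  mem
    | 0 => hI
    | n + 1 => F.mem n
  d
    | 0 => F.η ∘ₗ (LinearMap.range η).mkQ
    | n + 1 => F.d n
  η := η
  η_injective := hη
  exact_zero x := by
    change F.η (Submodule.Quotient.mk x) = 0 ↔ x ∈ LinearMap.range η
    rw [← map_zero F.η, F.η_injective.eq_iff]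
    exact Submodule.Quotient.mk_eq_zero _
  exact_succ
    | 0 => fun x ↦ (F.exact_zero x).trans
      ((Submodule.mkQ_surjective _).exists (p := fun y ↦ F.η y = x))
    | n + 1 => F.exact_succ n

end Coresolution

/-! ### Agreement with the classical homological dimensions -/

/-- The class of projective modules. -/
abbrev IsProj (M : ModuleCat.{u} R) : Prop := Module.Projective R M

/-- The class of injective modules. -/
abbrev IsInj (M : ModuleCat.{u} R) : Prop := Module.Injective R M

lemma hasProjectiveDimensionLT_of_resolution (n : ℕ) :
    ∀ {M : ModuleCat.{u} R} (F : Resolution IsProj M),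
      (∀ m, n ≤ m → Subsingleton (F.X m)) → HasProjectiveDimensionLT M n := by
  induction n with
  | zero =>
    intro M F h
    have := h 0 le_rfl
    have : Subsingleton M := F.ε_surjective.subsingleton
    exact (ModuleCat.isZero_of_subsingleton M).hasProjectiveDimensionLT_zero
  | succ n ih =>
    intro M F h
    have h1 := ih F.syzygy fun m hm ↦ h (m + 1) (by omega)
    have : Module.Projective R (F.X 0) := F.mem 0
    have : Projective (ModuleCat.of R (F.X 0)) := (F.X 0).projective_of_categoryTheory_projective
    exact (LinearMap.shortExact_shortComplexKer F.ε_surjective).hasProjectiveDimensionLT_X₃ n h1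
      (hasProjectiveDimensionLT_of_ge _ 1 (n + 1) (by omega))

lemma exists_resolution_of_hasProjectiveDimensionLT (n : ℕ) :
    ∀ (M : ModuleCat.{u} R), HasProjectiveDimensionLT M n →
      ∃ F : Resolution IsProj M, ∀ m, n ≤ m → Subsingleton (F.X m) := by
  have h0 : IsProj (ModuleCat.of R PUnit) :=
    inferInstanceAs (Module.Projective R PUnit.{u + 1})
  induction n with
  | zero =>
    intro M hM
    have := ModuleCat.subsingleton_of_isZero (isZero_of_hasProjectiveDimensionLT_zero M)
    exact ⟨.zero h0, fun m _ ↦ inferInstanceAs (Subsingleton PUnit)⟩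
  | succ n ih =>
    intro M hM
    obtain ⟨P, hP, ε, hε, hK⟩ : ∃ (P : ModuleCat.{u} R) (_ : IsProj P) (ε : P →ₗ[R] M)
        (_ : Function.Surjective ε),
        HasProjectiveDimensionLT (ModuleCat.of R (LinearMap.ker ε)) n := by
      cases n with
      | zero =>
        -- The kernel must be zero here, so `M` covers itself; a free cover would not do.
        have : Projective M := projective_iff_hasProjectiveDimensionLT_one.2 hM
        refine ⟨M, M.projective_of_module_projective, LinearMap.id, Function.surjective_id, ?_⟩
        rw [LinearMap.ker_id]
        exact (ModuleCat.isZero_of_subsingleton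
          (ModuleCat.of R (⊥ : Submodule R M))).hasProjectiveDimensionLT_zero
      | succ n =>
        have hs := Finsupp.linearCombination_id_surjective R M
        have hP : Module.Projective R (M →₀ R) := inferInstance
        have : Projective (ModuleCat.of R (M →₀ R)) :=
          (ModuleCat.of R (M →₀ R)).projective_of_categoryTheory_projective
        exact ⟨ModuleCat.of R (M →₀ R), hP, Finsupp.linearCombination R id, hs,
          (LinearMap.shortExact_shortComplexKer hs).hasProjectiveDimensionLT_X₁ (n + 1)
            (hasProjectiveDimensionLT_of_ge _ 1 (n + 1) (by omega)) hM⟩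
    obtain ⟨F, hF⟩ := ih _ hK
    refine ⟨.cons P hP ε hε F, fun m hm ↦ ?_⟩
    obtain ⟨m, rfl⟩ : ∃ k, m = k + 1 := ⟨m - 1, by omega⟩
    exact hF m (by omega)

lemma relProjDim_isProj (M : ModuleCat.{u} R) : relProjDim IsProj M = projectiveDimension M := by
  refine le_antisymm ?_ ?_ <;> refine withBot_enat_le_of_forall_lt fun n h ↦ ?_
  · exact (relProjDim_lt_iff _ _ _).2
      (exists_resolution_of_hasProjectiveDimensionLT n M (projectiveDimension_lt_iff.1 h))
  · obtain ⟨F, hF⟩ := (relProjDim_lt_iff _ _ _).1 h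
    exact projectiveDimension_lt_iff.2 (hasProjectiveDimensionLT_of_resolution n F hF)

lemma shortExact_mkQ_range {M I : ModuleCat.{u} R} {η : M →ₗ[R] I} (hη : Function.Injective η) :
    (ModuleCat.shortComplexOfCompEqZero η (LinearMap.range η).mkQ
      (LinearMap.range_mkQ_comp η)).ShortExact :=
  ModuleCat.shortComplex_shortExact _ (LinearMap.exact_map_mkQ_range η) hη
    (Submodule.mkQ_surjective _)

lemma hasInjectiveDimensionLT_of_coresolution (n : ℕ) :
    ∀ {M : ModuleCat.{u} R} (F : Coresolution IsInj M),
      (∀ m, n ≤ m → Subsingleton (F.X m)) → HasInjectiveDimensionLT M n := by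
  induction n with
  | zero =>
    intro M F h
    have := h 0 le_rfl
    have : Subsingleton M := F.η_injective.subsingleton
    exact (ModuleCat.isZero_of_subsingleton M).hasInjectiveDimensionLT_zero
  | succ n ih =>
    intro M F h
    have h1 := ih F.cosyzygy fun m hm ↦ h (m + 1) (by omega)
    have : Module.Injective R (F.X 0) := F.mem 0
    have : Injective (ModuleCat.of R (F.X 0)) := Module.injective_object_of_injective_module R _
    exact (shortExact_mkQ_range F.η_injective).hasInjectiveDimensionLT_X₁ n h1
      (hasInjectiveDimensionLT_of_ge _ 1 (n + 1) (by omega))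

lemma exists_injective_embedding (M : ModuleCat.{u} R) :
    ∃ (I : ModuleCat.{u} R) (_ : IsInj I) (η : M →ₗ[R] I), Function.Injective η :=
  ⟨(Injective.under M : ModuleCat.{u} R),
    (Module.injective_iff_injective_object R (Injective.under M : ModuleCat.{u} R)).2
      (inferInstance : Injective (Injective.under M : ModuleCat.{u} R)),
    (Injective.ι M).hom, (ModuleCat.mono_iff_injective _).1 inferInstance⟩

lemma exists_coresolution_of_hasInjectiveDimensionLT (n : ℕ) :
    ∀ (M : ModuleCat.{u} R), HasInjectiveDimensionLT M n →
      ∃ F : Coresolution IsInj M, ∀ m, n ≤ m → Subsingleton (F.X m) := by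
  have h0 : IsInj (ModuleCat.of R PUnit) :=
    ⟨fun X Y _ _ _ _ f hf g ↦ ⟨0, fun _ ↦ Subsingleton.elim (α := PUnit) _ _⟩⟩
  induction n with
  | zero =>
    intro M hM
    have := ModuleCat.subsingleton_of_isZero (isZero_of_hasInjectiveDimensionLT_zero M)
    exact ⟨.zero h0, fun m _ ↦ inferInstanceAs (Subsingleton PUnit)⟩
  | succ n ih =>
    intro M hM
    obtain ⟨I, hI, η, hη, hK⟩ : ∃ (I : ModuleCat.{u} R) (_ : IsInj I) (η : M →ₗ[R] I)
        (_ : Function.Injective η),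
        HasInjectiveDimensionLT (ModuleCat.of R (I ⧸ LinearMap.range η)) n := by
      cases n with
      | zero =>
        have : Injective M := injective_iff_hasInjectiveDimensionLT_one.2 hM
        refine ⟨M, (Module.injective_iff_injective_object R M).2 this, LinearMap.id,
          Function.injective_id, ?_⟩
        rw [LinearMap.range_id]
        exact (ModuleCat.isZero_of_subsingleton
          (ModuleCat.of R (M ⧸ (⊤ : Submodule R M)))).hasInjectiveDimensionLT_zero
      | succ n =>
        obtain ⟨I, hI, η, hη⟩ := exists_injective_embedding M
        have : Injective (ModuleCat.of R I) := (Module.injective_iff_injective_object R I).1 hI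
        exact ⟨I, hI, η, hη, (shortExact_mkQ_range hη).hasInjectiveDimensionLT_X₃ (n + 1)
          (hasInjectiveDimensionLT_of_ge _ 1 (n + 1) (by omega)) hM⟩
    obtain ⟨F, hF⟩ := ih _ hK
    refine ⟨.cons I hI η hη F, fun m hm ↦ ?_⟩
    obtain ⟨m, rfl⟩ : ∃ k, m = k + 1 := ⟨m - 1, by omega⟩
    exact hF m (by omega)

lemma relInjDim_isInj (M : ModuleCat.{u} R) : relInjDim IsInj M = injectiveDimension M := by
  refine le_antisymm ?_ ?_ <;> refine withBot_enat_le_of_forall_lt fun n h ↦ ?_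
  · exact (relInjDim_lt_iff _ _ _).2
      (exists_coresolution_of_hasInjectiveDimensionLT n M (injectiveDimension_lt_iff.1 h))
  · obtain ⟨F, hF⟩ := (relInjDim_lt_iff _ _ _).1 h
    exact injectiveDimension_lt_iff.2 (hasInjectiveDimensionLT_of_coresolution n F hF)

/-- A bound below `n` on either side means that `Ext^i` vanishes on all pairs of modules for `i ≥
n`, a condition symmetric in the two dimensions. -/
lemma iSup_injectiveDimension_eq_gldim :
    ⨆ M : ModuleCat.{u} R, injectiveDimension M = gldim R := by
  refine le_antisymm (iSup_le fun M ↦ ?_) (iSup_le fun M ↦ ?_) <;>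
    refine withBot_enat_le_of_forall_lt fun n h ↦ ?_
  · rw [injectiveDimension_lt_iff, hasInjectiveDimensionLT_iff.{u}]
    intro i hi N e
    have := projectiveDimension_lt_iff.1 ((le_iSup _ N).trans_lt h)
    exact e.eq_zero_of_hasProjectiveDimensionLT n hi
  · rw [projectiveDimension_lt_iff, hasProjectiveDimensionLT_iff.{u}]
    intro i hi N e
    have := injectiveDimension_lt_iff.1 ((le_iSup _ N).trans_lt h)
    exact e.eq_zero_of_hasInjectiveDimensionLT n hi

/-! ### Faithfulness, trace ideals and projectivity -/

section Modules

variable {C : Type u} [AddCommGroup C] [Module R C]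

lemma faithful_of_lsmul_injective (h : Function.Injective (LinearMap.lsmul R C)) (r : R)
    (hr : ∀ c : C, r • c = 0) : r = 0 :=
  h (by ext c; simp [hr c])

/-- A finite faithful module does not satisfy `C = mC` for a proper ideal `m`. -/
lemma ideal_eq_top_of_smul_top_eq_top [Module.Finite R C]
    (h : Function.Injective (LinearMap.lsmul R C)) (m : Ideal R)
    (hm : m • (⊤ : Submodule R C) = ⊤) : m = ⊤ := by
  obtain ⟨r, hr, h0⟩ := Submodule.exists_sub_one_mem_and_smul_eq_zero_of_fg_of_le_smul m
    (⊤ : Submodule R C) Module.Finite.fg_top hm.ge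
  have : r = 0 := faithful_of_lsmul_injective h r fun c ↦ h0 c trivial
  rw [Ideal.eq_top_iff_one, ← neg_mem_iff]
  simpa [this] using hr

/-- A nonzero finite `Q` surjects onto some residue field `R/m`, and then `Q ⊗ C = 0` would give `C
= mC`. -/
lemma subsingleton_of_subsingleton_tensorProduct [Module.Finite R C]
    (h : Function.Injective (LinearMap.lsmul R C)) (Q : Type u) [AddCommGroup Q] [Module R Q]
    [Module.Finite R Q] [Subsingleton (Q ⊗[R] C)] : Subsingleton Q := by
  by_contra hQ
  rw [not_subsingleton_iff_nontrivial] at hQ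
  obtain ⟨Q₀, hQ₀, -⟩ := (eq_top_or_exists_le_coatom (⊥ : Submodule R Q)).resolve_left bot_ne_top
  obtain ⟨m, hm, ⟨e⟩⟩ := isSimpleModule_iff_quot_maximal.1 (isSimpleModule_iff_isCoatom.2 hQ₀)
  have hs : Function.Surjective (e.toLinearMap ∘ₗ Q₀.mkQ) :=
    e.surjective.comp (Submodule.mkQ_surjective _)
  have h1 : Subsingleton ((R ⧸ m) ⊗[R] C) :=
    (LinearMap.rTensor_surjective C hs).subsingleton
  have h2 : Subsingleton (C ⧸ m • (⊤ : Submodule R C)) :=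
    (TensorProduct.quotTensorEquivQuotSMul C m).symm.toEquiv.subsingleton
  exact hm.ne_top (ideal_eq_top_of_smul_top_eq_top h m
    (Submodule.Quotient.subsingleton_iff.1 h2))

/-- If all maps to a finite faithful module extend along a map of finite projective modules, then
this map is a split injection. -/
lemma exists_leftInverse_of_extends [Module.Finite R C]
    (h : Function.Injective (LinearMap.lsmul R C)) {K P : Type u} [AddCommGroup K] [Module R K]
    [AddCommGroup P] [Module R P] [Module.Finite R K] [Module.Projective R K] [Module.Finite R P]
    [Module.Projective R P] (i : K →ₗ[R] P)
    (hi : ∀ f : K →ₗ[R] C, ∃ g : P →ₗ[R] C, g ∘ₗ i = f) :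
    ∃ s : P →ₗ[R] K, s ∘ₗ i = LinearMap.id := by
  -- Under `Hom(K, C) ≅ K* ⊗ C`, the extension hypothesis says that `i* ⊗ C` is onto. So the
  -- cokernel of `i*` dies on tensoring with `C`, hence is zero.
  have hsurj : Function.Surjective (i.dualMap.rTensor C) := by
    intro t
    obtain ⟨g, hg⟩ := hi (dualTensorHom R K C t)
    obtain ⟨t', rfl⟩ := (dualTensorHomEquiv R P C).surjective g
    refine ⟨t', (dualTensorHomEquiv R K C).injective ?_⟩
    change dualTensorHom R K C _ = dualTensorHom R K C t
    rw [← hg]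
    change _ = LinearMap.lcomp R C i (dualTensorHom R P C t')
    rw [← LinearMap.comp_apply, ← LinearMap.comp_apply]
    congr 1
    ext
    simp
  let N := LinearMap.range i.dualMap
  have h1 : Subsingleton ((Module.Dual R K ⧸ N) ⊗[R] C) := by
    refine subsingleton_of_forall_eq 0 fun x ↦ ?_
    obtain ⟨y, rfl⟩ := LinearMap.rTensor_surjective C (Submodule.mkQ_surjective N) x
    obtain ⟨z, rfl⟩ := hsurj y
    rw [← LinearMap.rTensor_comp_apply, LinearMap.range_mkQ_comp, LinearMap.rTensor_zero,
      LinearMap.zero_apply]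
  have h2 := subsingleton_of_subsingleton_tensorProduct h (Module.Dual R K ⧸ N)
  have h3 : Function.Surjective i.dualMap :=
    LinearMap.range_eq_top.1 (Submodule.Quotient.subsingleton_iff.1 h2)
  obtain ⟨n, f, g, -, -, hfg⟩ := Module.Finite.exists_comp_eq_id_of_projective R K
  -- `K` is a retract of `Rⁿ`; extend each coordinate of `g` along `i`, then project back by `f`.
  choose t ht using fun k : Fin n ↦ h3 (LinearMap.proj k ∘ₗ g)
  refine ⟨f ∘ₗ LinearMap.pi t, ?_⟩
  rw [← hfg, LinearMap.comp_assoc]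
  congr 1
  ext x k
  exact LinearMap.congr_fun (ht k) x

/-- If the trace ideal of a module with endomorphism ring `R` is `R`, the module is projective. -/
lemma projective_of_sum_eq_one (h : Function.Bijective (LinearMap.lsmul R C)) {ι : Type*}
    (s : Finset ι) (f : ι → Module.Dual R C) (c : ι → C) (hs : ∑ i ∈ s, f i (c i) = 1) :
    Module.Projective R C := by
  let e : R ≃ₗ[R] (C →ₗ[R] C) := LinearEquiv.ofBijective (LinearMap.lsmul R C) h
  have : Module.Projective R (C →ₗ[R] C) := .of_equiv e
  have : Module.Projective R (s → (C →ₗ[R] C)) :=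
    .of_equiv (DFinsupp.linearEquivFunOnFintype (R := R) (M := fun _ : s ↦ C →ₗ[R] C))
  -- `x ↦ (c ↦ fᵢ(c) x)ᵢ`, followed by evaluation at the `cᵢ` and summation, is multiplication by `∑
  -- fᵢ(cᵢ) = 1`.
  refine Module.Projective.of_split (M := s → (C →ₗ[R] C))
    (LinearMap.pi fun i ↦ LinearMap.smulRightₗ (f i))
    (∑ i : s, (LinearMap.applyₗ (c i)) ∘ₗ LinearMap.proj i) ?_
  ext x
  simp only [LinearMap.coe_comp, Function.comp_apply, LinearMap.coe_sum, Finset.sum_apply,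
    LinearMap.proj_apply, LinearMap.pi_apply, LinearMap.applyₗ_apply_apply,
    LinearMap.smulRightₗ_apply, LinearMap.smulRight_apply, LinearMap.id_apply]
  rw [← Finset.sum_smul, Finset.sum_coe_sort s (fun i ↦ f i (c i)), hs, one_smul]

lemma projective_of_surjective_tensorProduct (h : Function.Bijective (LinearMap.lsmul R C))
    {P : Type*} [AddCommGroup P] [Module R P] (g : C ⊗[R] P →ₗ[R] R)
    (hg : Function.Surjective g) : Module.Projective R C := by
  obtain ⟨t, ht⟩ := hg 1
  obtain ⟨S, rfl⟩ := TensorProduct.exists_finset t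
  refine projective_of_sum_eq_one h S (fun i ↦ g ∘ₗ (TensorProduct.mk R C P).flip i.2)
    (fun i ↦ i.1) ?_
  simpa using ht

/-- The trace ideal of a module. -/
def traceIdeal (C : Type u) [AddCommGroup C] [Module R C] : Ideal R :=
  LinearMap.range (contractLeft R C)

lemma projective_of_traceIdeal_eq_top (h : Function.Bijective (LinearMap.lsmul R C))
    (ht : traceIdeal (R := R) C = ⊤) : Module.Projective R C :=
  projective_of_surjective_tensorProduct h
    (contractLeft R C ∘ₗ (TensorProduct.comm R C (Module.Dual R C)).toLinearMap)
    ((LinearMap.range_eq_top.1 ht).comp (LinearEquiv.surjective _))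

/-- An element of an injective module `J` killed by the trace ideal of `C` is killed by every map
from `J` to a module `Hom(C, I)`. -/
lemma apply_eq_zero_of_traceIdeal_smul [Module.FinitePresentation R C] {J I : Type u}
    [AddCommGroup J] [Module R J] [Module.Injective R J] [AddCommGroup I] [Module R I]
    (φ : J →ₗ[R] C →ₗ[R] I) (j : J) (hj : ∀ r ∈ traceIdeal (R := R) C, r • j = 0) : φ j = 0 := by
  obtain ⟨n, m, f, g, hf, hfg⟩ := Module.FinitePresentation.exists_fin' R C
  suffices ∀ x : Fin n → R, φ j (f x) = 0 by
    ext c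
    obtain ⟨x, rfl⟩ := hf c
    exact this x
  intro x
  let D := g.dualMap
  let ψ : Module.Dual R (Fin n → R) →ₗ[R] J :=
    LinearMap.toSpanSingleton R J j ∘ₗ Module.Dual.eval R (Fin n → R) x
  -- A functional `u` with `u ∘ g = 0` descends to `C`, so `u x` lies in the trace ideal and kills
  -- `j`. Hence `u ∘ g ↦ u x • j` is well defined on the range of `D`, and injectivity of `J`
  -- extends it to `G`.
  have hψ : LinearMap.ker D ≤ LinearMap.ker ψ := by
    intro u hu
    have hu' : u ∘ₗ g = 0 := hu
    let v : Module.Dual R C := (LinearMap.range g).liftQ u (by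
      rintro _ ⟨y, rfl⟩
      exact LinearMap.congr_fun hu' y) ∘ₗ (hfg.linearEquivOfSurjective hf).symm.toLinearMap
    have hv : v (f x) = u x := by
      have : (hfg.linearEquivOfSurjective hf).symm (f x) = Submodule.Quotient.mk x := by
        rw [LinearEquiv.symm_apply_eq]
        rfl
      simp only [v, LinearMap.comp_apply, LinearEquiv.coe_coe, this]
      exact Submodule.liftQ_apply _ _ _
    change u x • j = 0
    refine hj _ ⟨v ⊗ₜ f x, ?_⟩
    simp [hv]
  obtain ⟨G, hG⟩ := Module.Injective.out (Q := J) ((LinearMap.ker D).liftQ D le_rfl)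
    (by rw [← LinearMap.ker_eq_bot, Submodule.ker_liftQ_eq_bot' _ _ rfl])
    ((LinearMap.ker D).liftQ ψ hψ)
  have hG' (u : Module.Dual R (Fin n → R)) : G (u ∘ₗ g) = u x • j := hG (Submodule.Quotient.mk u)
  have hG'' (i : Fin n) :
      ∑ k, g (Pi.single k 1) i • G (LinearMap.proj k) = x i • j := by
    refine Eq.trans ?_ (hG' (LinearMap.proj i))
    simp_rw [← map_smul, ← map_sum]
    congr 1
    refine LinearMap.pi_ext' fun k ↦ LinearMap.ext_ring ?_
    simp [Pi.single_apply]
  have hsum (y : Fin n → R) (a : C →ₗ[R] I) :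
      a (f y) = ∑ i, y i • a (f (Pi.single i 1)) := by
    conv_lhs => rw [pi_eq_sum_univ' y]
    simp only [map_sum, map_smul]
  -- `G` expresses each `x i • j` through the entries of `g`; swapping the sums moves those entries
  -- inside `f`, where `f ∘ g = 0`.
  calc φ j (f x) = ∑ i, φ (x i • j) (f (Pi.single i 1)) := by simp [hsum x (φ j)]
    _ = ∑ k, φ (G (LinearMap.proj k)) (f (g (Pi.single k 1))) := by
      simp only [← hG'', map_sum, map_smul, LinearMap.sum_apply, LinearMap.smul_apply]
      rw [Finset.sum_comm]
      exact Finset.sum_congr rfl fun k _ ↦ (hsum _ _).symm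
    _ = 0 := by simp [hfg.apply_apply_eq_zero]

/-- A finite projective module with endomorphism ring `R` is invertible. -/
lemma invertible_of_projective [Module.Finite R C] [Module.Projective R C]
    (h : Function.Bijective (LinearMap.lsmul R C)) : Module.Invertible R C :=
  .right (dualTensorHomEquiv R C C ≪≫ₗ (LinearEquiv.ofBijective (LinearMap.lsmul R C) h).symm)

end Modules

/-! ### The classes `𝒫_C` and `ℐ_C` for invertible `C` -/

lemma cProjective_iff (C : ModuleCat.{u} R) [Module.Invertible R C] (M : ModuleCat.{u} R) :
    CProjective C M ↔ Module.Projective R M := by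
  constructor
  · rintro ⟨P, hP, ⟨e⟩⟩
    exact .of_equiv e.symm
  · intro hM
    exact ⟨ModuleCat.of R (Module.Dual R C ⊗[R] M),
      inferInstanceAs (Module.Projective R (Module.Dual R C ⊗[R] M)),
      ⟨(Module.Invertible.leftCancelEquiv M (TensorProduct.comm R _ _ ≪≫ₗ
        Module.Invertible.linearEquiv R C)).symm⟩⟩

/-- By adjunction, extending a map into `Hom(N, I)` along `f` is extending a map into `I` along `f ⊗
N`, which is still injective. -/
lemma injective_hom_of_flat (N I : Type u) [AddCommGroup N] [Module R N] [AddCommGroup I]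
    [Module R I] [Module.Flat R N] [Module.Injective R I] : Module.Injective R (N →ₗ[R] I) where
  out X Y _ _ _ _ f hf g := by
    obtain ⟨h, hh⟩ := Module.Injective.out (f.rTensor N)
      (Module.Flat.rTensor_preserves_injective_linearMap f hf) (TensorProduct.lift g)
    refine ⟨TensorProduct.curry h, fun x ↦ LinearMap.ext fun n ↦ ?_⟩
    simpa using hh (x ⊗ₜ n)

lemma cInjective_iff (C : ModuleCat.{u} R) [Module.Invertible R C] (M : ModuleCat.{u} R) :
    CInjective C M ↔ Module.Injective R M := by
  have of_equiv {A B : Type u} [AddCommGroup A] [Module R A] [AddCommGroup B] [Module R B]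
      (e : A ≃ₗ[R] B) (h : Module.Injective R A) : Module.Injective R B :=
    ⟨fun X Y _ _ _ _ f hf g ↦ by
      obtain ⟨k, hk⟩ := h.out f hf (e.symm.toLinearMap ∘ₗ g)
      exact ⟨e.toLinearMap ∘ₗ k, fun x ↦ by simp [hk]⟩⟩
  constructor
  · rintro ⟨I, hI, ⟨e⟩⟩
    exact of_equiv e.symm (injective_hom_of_flat C I)
  · intro hM
    refine ⟨ModuleCat.of R (Module.Dual R C →ₗ[R] M),
      injective_hom_of_flat (Module.Dual R C) M, ⟨?_⟩⟩
    -- `M ≅ Hom(R, M) ≅ Hom(C ⊗ C*, M) ≅ Hom(C, Hom(C*, M))`.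
    exact (LinearMap.ringLmapEquivSelf R R M).symm ≪≫ₗ
      (TensorProduct.comm R _ _ ≪≫ₗ Module.Invertible.linearEquiv R C).symm.congrLeft M R ≪≫ₗ
      (TensorProduct.lift.equiv (.id R) C (Module.Dual R C) M).symm

/-! ### Finite projective dimension and `Ext` vanishing -/

/-- A module with a resolution by finite projective modules is finitely presented. -/
lemma finitePresentation_of_resolution {C : ModuleCat.{u} R}
    (F : Resolution (fun P : ModuleCat.{u} R ↦ Module.Finite R P ∧ Module.Projective R P) C) :
    Module.FinitePresentation R C := by
  have := (F.mem 0).1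
  have := (F.mem 0).2
  have := (F.mem 1).1
  have := Module.finitePresentation_of_projective R (F.X 0)
  refine Module.finitePresentation_of_surjective F.ε F.ε_surjective ?_
  rw [LinearMap.exact_iff.1 F.exact_zero]
  exact Submodule.fg_range _

/-- A module of finite projective dimension with a resolution by finite projective modules is
projective if its higher `Ext` groups with values in a finite faithful module vanish. -/
lemma projective_of_ext_vanishing (C : ModuleCat.{u} R) [Module.Finite R C]
    (h : Function.Injective (LinearMap.lsmul R C)) (n : ℕ) :
    ∀ (K : ModuleCat.{u} R),
      Resolution (fun P : ModuleCat.{u} R ↦ Module.Finite R P ∧ Module.Projective R P) K →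
      HasProjectiveDimensionLT K (n + 1) →
      (∀ i : ℕ, 1 ≤ i → Subsingleton (Abelian.Ext.{u} K C i)) → Projective K := by
  induction n with
  | zero => exact fun K _ hK _ ↦ projective_iff_hasProjectiveDimensionLT_one.2 hK
  | succ n ih =>
    intro K F hK hext
    have := (F.mem 0).1
    have := (F.mem 0).2
    have hproj : Projective (ModuleCat.of R (F.X 0)) :=
      (F.X 0).projective_of_categoryTheory_projective
    have hS := LinearMap.shortExact_shortComplexKer F.ε_surjective
    have h1 : Projective (ModuleCat.of R (LinearMap.ker F.ε)) := by
      -- Dimension shift: `Ext^i` of the syzygy sits between `Ext^i(X₀, C) = 0` and `Ext^{1+i}(K, C)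
      -- = 0`.
      refine ih _ F.syzygy ((hS.hasProjectiveDimensionLT_X₃_iff n hproj).1 hK) fun i hi ↦ ?_
      refine subsingleton_of_forall_eq 0 fun e ↦ ?_
      have := hext (1 + i) (by omega)
      obtain ⟨e', rfl⟩ := Abelian.Ext.contravariant_sequence_exact₁ hS _ e rfl
        (Subsingleton.elim (α := Abelian.Ext.{u} K C (1 + i)) _ _)
      obtain ⟨i, rfl⟩ : ∃ k, i = k + 1 := ⟨i - 1, by omega⟩
      have : e' = 0 := Abelian.Ext.eq_zero_of_projective (P := ModuleCat.of R (F.X 0)) e'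
      rw [this, Abelian.Ext.comp_zero]
    have : Module.Projective R (LinearMap.ker F.ε) :=
      (ModuleCat.of R (LinearMap.ker F.ε)).projective_of_module_projective
    have : Module.Finite R (LinearMap.ker F.ε) :=
      have : Module.Finite R (F.syzygy.X 0) := (F.mem 1).1
      .of_surjective F.syzygy.ε F.syzygy.ε_surjective
    -- `Ext¹(K, C) = 0` lets every map from the syzygy to `C` extend to `X₀`, so the syzygy splits
    -- off and `K` is a retract of `X₀`.
    obtain ⟨s, hs⟩ := exists_leftInverse_of_extends h (LinearMap.ker F.ε).subtype fun f ↦ by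
      have := hext 1 le_rfl
      obtain ⟨e, he⟩ := Abelian.Ext.contravariant_sequence_exact₁ hS C
        (Abelian.Ext.mk₀ (ModuleCat.ofHom f)) rfl
        (Subsingleton.elim (α := Abelian.Ext.{u} K C 1) _ _)
      obtain ⟨g, rfl⟩ := Abelian.Ext.homEquiv₀.symm.surjective e
      refine ⟨g.hom, ?_⟩
      rw [Abelian.Ext.homEquiv₀_symm_apply, Abelian.Ext.mk₀_comp_mk₀] at he
      exact congrArg ModuleCat.Hom.hom (Abelian.Ext.homEquiv₀.symm.injective he)
    let σ : (LinearMap.shortComplexKer F.ε).Splitting :=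
      .ofExactOfRetraction _ hS.exact (ModuleCat.ofHom s) (ModuleCat.hom_ext hs)
        hS.epi_g
    exact (Retract.mk σ.s (LinearMap.shortComplexKer F.ε).g σ.s_g : Retract K (F.X 0)).projective

/-! ### Finiteness of any of the three dimensions forces `C` to be projective -/

variable {C : ModuleCat.{u} R}

lemma IsSemidualizing.finitePresentation (hC : IsSemidualizing C) :
    Module.FinitePresentation R C :=
  hC.exists_resolution.elim finitePresentation_of_resolution

lemma IsSemidualizing.projective_of_cProjGlobalDim_ne_top (hC : IsSemidualizing C)
    (h : CProjGlobalDim C ≠ ⊤) : Module.Projective R C := by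
  have h1 : relProjDim (CProjective C) (ModuleCat.of R R) < ⊤ :=
    (le_iSup _ _).trans_lt (lt_top_iff_ne_top.2 h)
  obtain ⟨F, -⟩ := iInf_lt_iff.1 h1
  obtain ⟨P, -, ⟨e⟩⟩ := F.mem 0
  exact projective_of_surjective_tensorProduct hC.homothety_bijective (F.ε ∘ₗ e.symm.toLinearMap)
    (F.ε_surjective.comp e.symm.surjective)

lemma IsSemidualizing.projective_of_cInjGlobalDim_ne_top (hC : IsSemidualizing C)
    (h : CInjGlobalDim C ≠ ⊤) : Module.Projective R C := by
  have := hC.finitePresentation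
  obtain ⟨J, hJ, η, hη⟩ :=
    exists_injective_embedding (ModuleCat.of R (R ⧸ traceIdeal (R := R) C))
  have h1 : relInjDim (CInjective C) J < ⊤ := (le_iSup _ _).trans_lt (lt_top_iff_ne_top.2 h)
  obtain ⟨F, -⟩ := iInf_lt_iff.1 h1
  obtain ⟨I, -, ⟨e⟩⟩ := F.mem 0
  refine projective_of_traceIdeal_eq_top hC.homothety_bijective ?_
  rw [Ideal.eq_top_iff_one, ← Ideal.Quotient.eq_zero_iff_mem]
  -- The class of `1` is killed by the trace ideal, so its image in `Hom(C, I)` is zero; as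
  -- `R/tr(C)` embeds there, `1` lies in the trace ideal.
  have h2 := apply_eq_zero_of_traceIdeal_smul (e.toLinearMap ∘ₗ F.η)
    (η (1 : R ⧸ traceIdeal (R := R) C)) fun r hr ↦ by
      rw [← map_smul, Algebra.smul_def, mul_one, Ideal.Quotient.algebraMap_eq,
        Ideal.Quotient.eq_zero_iff_mem.2 hr, map_zero]
  exact (map_eq_zero_iff (e.toLinearMap ∘ₗ F.η ∘ₗ η)
    (e.injective.comp (F.η_injective.comp hη))).1 h2

lemma IsSemidualizing.projective_of_gldim_ne_top (hC : IsSemidualizing C)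
    (h : gldim R ≠ ⊤) : Module.Projective R C := by
  have := hC.finitePresentation
  have h1 : projectiveDimension C ≠ ⊤ :=
    ((le_iSup _ C).trans_lt (lt_top_iff_ne_top.2 h)).ne
  obtain ⟨n, hn⟩ := (projectiveDimension_ne_top_iff C).1 h1
  have := projective_of_ext_vanishing C hC.homothety_bijective.1 n C hC.exists_resolution.some hn
    hC.ext_vanishing
  exact C.projective_of_module_projective

lemma cProjGlobalDim_eq_gldim (C : ModuleCat.{u} R) [Module.Invertible R C] :
    CProjGlobalDim C = gldim R := by
  have : CProjective C = IsProj := funext fun M ↦ propext (cProjective_iff C M)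
  simp only [CProjGlobalDim, this, relProjDim_isProj, gldim]

lemma cInjGlobalDim_eq_gldim (C : ModuleCat.{u} R) [Module.Invertible R C] :
    CInjGlobalDim C = gldim R := by
  have : CInjective C = IsInj := funext fun M ↦ propext (cInjective_iff C M)
  simp only [CInjGlobalDim, this, relInjDim_isInj, iSup_injectiveDimension_eq_gldim]

end RelDim
end

theorem proposition4p1 {R : Type u} [CommRing R] (C : ModuleCat.{u} R)
    (hC : RelDim.IsSemidualizing C) :
    RelDim.CProjGlobalDim C = RelDim.CInjGlobalDim C ∧
      RelDim.CProjGlobalDim C = RelDim.gldim R ∧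
      RelDim.CInjGlobalDim C = RelDim.gldim R := by
  suffices RelDim.CProjGlobalDim C = RelDim.gldim R ∧ RelDim.CInjGlobalDim C = RelDim.gldim R from
    ⟨this.1.trans this.2.symm, this⟩
  by_cases hproj : Module.Projective R C
  · have := hC.finitePresentation
    have := RelDim.invertible_of_projective hC.homothety_bijective
    exact ⟨RelDim.cProjGlobalDim_eq_gldim C, RelDim.cInjGlobalDim_eq_gldim C⟩
  · have h1 := not_imp_comm.1 hC.projective_of_cProjGlobalDim_ne_top hproj
    have h2 := not_imp_comm.1 hC.projective_of_cInjGlobalDim_ne_top hproj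
    have h3 := not_imp_comm.1 hC.projective_of_gldim_ne_top hproj
    exact ⟨h1.trans h3.symm, h2.trans h3.symm⟩
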